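/- **Setting.** Let $0<\alpha\le 1$ and let $\gamma=(\gamma_j)_{j\ge1}$ be a non-increasing sequence of positive reals. For a prime $b$ and $m\ge1$ let $R_{b,m}$ be the set of non-zero polynomials in $\mathbb Z_b[x]$ of degree less than $m$. For $k\in\mathbb N_0$ with base-$b$ expansion $k=\kappa_0+\kappa_1b+\cdots$ let $\mathrm{tr}_m(k)(x)=\kappa_0+\kappa_1x+\cdots+\kappa_{m-1}x^{m-1}\in\mathbb Z_b[x]$; for $\beta,g>0$ put $r_{\beta,g}(0)=1$ and $r_{\beta,g}(k)=g\,\frac{b}{(b-1)b^{\beta a}}$ if $k>0$ has exactly $a$ base-$b$ digits. For $p\in\mathbb Z_b[x]$ with $\deg p=m$ and $q=(q_1,\dots,q_s)\in\mathbb Z_b[x]^s$ let $$\mathcal D_p(q)=\Big\{k\in\mathbb N_0^s:\ \sum_{j=1}^s \mathrm{tr}_m(k_j)\,q_j\equiv0 \pmod p\Big\},\qquad B(q,\alpha,\gamma)=\sum_{k\in\mathcal D_p(q)\setminus\{0\}}\ \prod_{j=1}^s r_{2\alpha+1,\gamma_j}(k_j).$$ A vector $q^*_s=(q_1,\dots,q_s)\in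 R_{b,m}^s$ is *constructed by the CBC algorithm* with modulus $p$ if $q_1=1$ and, for each $d=2,\dots,s$, $q_d$ minimizes $g\mapsto B((q_1,\dots,q_{d-1},g),\alpha,\gamma)$ over $g\in R_{b,m}$. Finally let $$C_{b,\alpha,\lambda}=\max\Big(\frac1{(b^{2\alpha}-1)^\lambda},\ \frac{(b-1)^{1-\lambda}}{b^{2\alpha\lambda}-b^{1-\lambda}}\Big),\qquad c_{s,\alpha,\gamma,\delta}=\prod_{j=1}^s\Big[1+\gamma_j^{\frac1{2\alpha+1-\delta}}\,C_{b,\alpha,(2\alpha+1-\delta)^{-1}}\Big]^{2\alpha+1-\delta},$$ and let $c_{\infty,\alpha,\gamma,\delta}$ be the corresponding infinite product over $j\ge1$. **Corollary 4.2.** Let $b$ be prime, $s\ge 1$, $p\in\mathbb Z_b[x]$ irreducible with $\deg p=m\ge1$, and $N=b^m$. Suppose $q_s^*\in R_{b,m}^s$ is constructed by the CBC algorithm with modulus $p$. Then: 1. For all $0<\delta\le2\alpha$, $$B(q_s^*,\alpha,\gamma)\le c_{s,\alpha,\gamma,\delta}\,(N-1)^{-(2\alpha+1)+\delta}.$$ 2.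 For every $0<\delta\le 2\alpha$ with $\sum_{j=1}^\infty\gamma_j^{1/(2\alpha+1-\delta)}<\infty$, the infinite product $c_{\infty,\alpha,\gamma,\delta}$ converges, $c_{s,\alpha,\gamma,\delta}\le c_{\infty,\alpha,\gamma,\delta}<\infty$, and $$B(q_s^*,\alpha,\gamma)\le c_{\infty,\alpha,\gamma,\delta}\,(N-1)^{-(2\alpha+1)+\delta},$$ a bound independent of the dimension $s$. 3. If $$A:=\limsup_{s\to\infty}\frac{\sum_{j=1}^s\gamma_j}{\log s}<\infty,$$ then for every $\eta>0$ there is a constant $\tilde c_\eta>0$, which may depend on $\eta$ and on $\alpha$ and $\gamma$ but not on $s,b,m,p$ or $q_s^*$, such that $$c_{s,\alpha,\gamma,2\alpha}\le\tilde c_\eta\,(b-1)^{2\alpha}\,s^{\frac{A+\eta}{b^{2\alpha}-1}}\qquad\text{and}\qquad B(q_s^*,\alpha,\gamma)\le\tilde c_\eta\,s^{\frac{A+\eta}{b^{2\alpha}-1}}\,(N-1)^{-1},$$ so that the bound depends only polynomially on $s$. -/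

import Mathlib

open scoped Polynomial

noncomputable section

namespace PolyLattice

/-- The polynomial `tr_m(k)(x) = k_0 + k_1 x + ⋯ + k_{m-1} x^{m-1}` over `ℤ_b`, where
`k = k_0 + k_1 b + k_2 b² + ⋯` is the `b`-adic expansion of `k`. -/
def trPoly (b m k : ℕ) : (ZMod b)[X] :=
  ∑ r ∈ Finset.range m, Polynomial.C ((k / b ^ r % b : ℕ) : ZMod b) * Polynomial.X ^ r

/-- The dual polynomial lattice `𝒟_p(q)` of the polynomial lattice with modulus `p` (of degree `m`)
and generating vector `q = (q_1, …, q_s)`: all `k ∈ ℕ₀^s` such that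
`tr_m(k_1) q_1 + ⋯ + tr_m(k_s) q_s ≡ 0 (mod p)`. -/
def dualLattice {b s : ℕ} (p : (ZMod b)[X]) (q : Fin s → (ZMod b)[X]) : Set (Fin s → ℕ) :=
  {k | p ∣ ∑ j, trPoly b p.natDegree (k j) * q j}

/-- `r_{β,g}(k)`: it is `1` for `k = 0`, and `g · b / ((b - 1) b^{β a})` if `k > 0` has exactly `a`
digits in base `b`. -/
def rOne (b : ℕ) (β g : ℝ) (k : ℕ) : ℝ :=
  if k = 0 then 1
  else g * ((b : ℝ) / (((b : ℝ) - 1) * (b : ℝ) ^ (β * ((Nat.digits b k).length : ℝ))))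

/-- The product `r_{β,γ}(k) = ∏_j r_{β,γ_j}(k_j)` for `k ∈ ℕ₀^s`. Weights are indexed from `0`:
`γ j` is the weight of the coordinate number `j + 1`. -/
def rProd (b : ℕ) (β : ℝ) (γ : ℕ → ℝ) {s : ℕ} (k : Fin s → ℕ) : ℝ :=
  ∏ j : Fin s, rOne b β (γ (j : ℕ)) (k j)

/-- The quality criterion `B(q, α, γ) = ∑_{k ∈ 𝒟_p(q) ∖ {0}} r_{2α+1,γ}(k)`. The terms are
nonnegative (for nonnegative weights), and the sum is taken in `[0, ∞]`. -/
def critB {b s : ℕ} (p : (ZMod b)[X]) (q : Fin s → (ZMod b)[X]) (α : ℝ) (γ : ℕ → ℝ) : ENNReal :=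
  ∑' k : ↥(dualLattice p q \ {0}), ENNReal.ofReal (rProd b (2 * α + 1) γ (k : Fin s → ℕ))

/-- `R_{b,m}`: the nonzero polynomials over `ℤ_b` of degree less than `m`. -/
def R (b m : ℕ) : Set (ZMod b)[X] :=
  {g | g.degree < (m : WithBot ℕ) ∧ g ≠ 0}

/-- `q = (q_1, …, q_s) ∈ R_{b,m}^s` (with `m` the degree of `p`) is a possible output of the
component-by-component algorithm with modulus `p`: `q_1 = 1`, and for each `d = 2, …, s` the
polynomial `q_d` minimizes `g ↦ B((q_1, …, q_{d-1}, g), α, γ)` over `R_{b,m}`. Below, `d` is the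
number of components that have been chosen already. -/
structure IsCBC {b s : ℕ} (p : (ZMod b)[X]) (α : ℝ) (γ : ℕ → ℝ) (q : Fin s → (ZMod b)[X]) :
    Prop where
  mem : ∀ j, q j ∈ R b p.natDegree
  first : ∀ h : 0 < s, q ⟨0, h⟩ = 1
  minimal : ∀ (d : ℕ) (hd : d < s), 1 ≤ d → ∀ g ∈ R b p.natDegree,
    critB p (Fin.snoc (α := fun _ => (ZMod b)[X]) (fun i : Fin d => q (Fin.castLE hd.le i))
        (q ⟨d, hd⟩)) α γ
      ≤ critB p (Fin.snoc (α := fun _ => (ZMod b)[X]) (fun i : Fin d => q (Fin.castLE hd.le i))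
        g) α γ

/-- `C_{b,α,lam} = max ( 1 / (b^{2α} - 1)^lam , (b-1)^{1-lam} / (b^{2α lam} - b^{1-lam}) )`. -/
def constC (b : ℕ) (α lam : ℝ) : ℝ :=
  max (1 / ((b : ℝ) ^ (2 * α) - 1) ^ lam)
    (((b : ℝ) - 1) ^ (1 - lam) / ((b : ℝ) ^ (2 * α * lam) - (b : ℝ) ^ (1 - lam)))

/-- The factor `[1 + γ_j^{1/(2α+1-δ)} C_{b,α,1/(2α+1-δ)}]^{2α+1-δ}` (with `γ_j` written `g`). -/
def factor (b : ℕ) (α δ g : ℝ) : ℝ :=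
  (1 + g ^ (1 / (2 * α + 1 - δ)) * constC b α (1 / (2 * α + 1 - δ))) ^ (2 * α + 1 - δ)

/-- The constant `c_{s,α,γ,δ}`. -/
def constc (b s : ℕ) (α : ℝ) (γ : ℕ → ℝ) (δ : ℝ) : ℝ :=
  ∏ j ∈ Finset.range s, factor b α δ (γ j)

/-- The constant `c_{∞,α,γ,δ}`, an infinite product. -/
def constcInf (b : ℕ) (α : ℝ) (γ : ℕ → ℝ) (δ : ℝ) : ℝ :=
  ∏' j : ℕ, factor b α δ (γ j)

end PolyLattice

end

/-! ### Subadditivity of powers with exponent at most one. -/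

namespace ENNReal

/-! Put λ = 1/(2α+1-δ), so that 0 < λ ≤ 1 and (2α+1)λ > 1. The core is the estimate (N-1)
B(q_1,…,q_d)^λ ≤ ∏_{j≤d} (1 + γ_j^λ W), with W = `weightConst b α λ`, proved by induction on d in
`card_mul_critB_rpow_le`.

A minimum is at most the average over the N-1 elements of R_{b,m}, and x ↦ x^λ is subadditive. It
therefore suffices to count, for fixed earlier coordinates k and last coordinate n > 0, the g that
satisfy the dual congruence (`card_filter_dvd_le`). Let S be the part of the congruence coming from
k. As p is irreducible, p ∤ S allows at most one g, while p ∣ S allows every g if b^m ∣ n and none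
otherwise. In the case p ∣ S, the decay of r along multiples of b^m absorbs the factor N-1. Either
way k contributes at most its weight times γ_d^λ W (`sum_tsum_ite_dvd_le`), which produces the next
factor of the product.

Raising to the power 1/λ gives part 1. Part 2 follows from log(1+x) ≤ x. For δ = 2α the factors are
1 + γ_j/(b^{2α}-1), and 1+x ≤ e^x turns logarithmic growth of ∑ γ_j into a power of s. -/

theorem rpow_tsum_le_tsum_rpow {ι : Type*} (f : ι → ENNReal) {t : ℝ} (h0 : 0 < t) (h1 : t ≤ 1) :
    (∑' i, f i) ^ t ≤ ∑' i, f i ^ t := by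
  have hfin : ∀ s : Finset ι, (∑ i ∈ s, f i) ^ t ≤ ∑ i ∈ s, f i ^ t := by
    classical
    intro s
    induction s using Finset.induction_on with
    | empty => simp [h0]
    | insert i s hi ih =>
      rw [Finset.sum_insert hi, Finset.sum_insert hi]
      exact (ENNReal.rpow_add_le_add_rpow _ _ h0.le h1).trans (by gcongr)
  rw [← ENNReal.le_rpow_inv_iff h0, ENNReal.tsum_eq_iSup_sum]
  refine iSup_le fun s => ?_
  rw [ENNReal.le_rpow_inv_iff h0]
  exact (hfin s).trans (ENNReal.sum_le_tsum s)

end ENNReal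

namespace PolyLattice

/-! ### One-dimensional sums of the weights r. -/

theorem rOne_nonneg {b : ℕ} (hb : 2 ≤ b) (β : ℝ) {g : ℝ} (hg : 0 ≤ g) (k : ℕ) :
    0 ≤ rOne b β g k := by
  have : (2 : ℝ) ≤ b := by exact_mod_cast hb
  unfold rOne
  split_ifs
  · exact zero_le_one
  · have : (0 : ℝ) < b - 1 := by linarith
    positivity

theorem rOne_pow_mul {b : ℕ} (hb : 2 ≤ b) (β g : ℝ) (m : ℕ) {k : ℕ} (hk : 0 < k) :
    rOne b β g (b ^ m * k) = ((b : ℝ) ^ (β * m))⁻¹ * rOne b β g k := by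
  have hb0 : (0 : ℝ) < b := by exact_mod_cast (by omega : 0 < b)
  have hne : b ^ m * k ≠ 0 := by positivity
  rw [rOne, rOne, if_neg hne, if_neg hk.ne', Nat.digits_base_pow_mul (by omega) hk]
  simp only [List.length_append, List.length_replicate, Nat.cast_add, mul_add]
  rw [Real.rpow_add hb0]
  field_simp

/-- The second entry of the maximum that defines `constC`. -/
noncomputable def weightConst (b : ℕ) (α lam : ℝ) : ℝ :=
  ((b : ℝ) - 1) ^ (1 - lam) / ((b : ℝ) ^ (2 * α * lam) - (b : ℝ) ^ (1 - lam))

/-- All b^(n+1) - b^n numbers with n+1 digits share one value of r, so the block total is geometric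
in n with ratio ρ = b^(1-(2α+1)λ). Displaying the factor 1-ρ makes the sum over blocks telescope. -/
theorem rOne_rpow_of_mem_Ico {b : ℕ} (hb : 2 ≤ b) (α : ℝ) {g : ℝ} (hg : 0 ≤ g) {lam : ℝ}
    (hlam : 1 < (2 * α + 1) * lam) {n k : ℕ} (hk : k ∈ Finset.Ico (b ^ n) (b ^ (n + 1))) :
    rOne b (2 * α + 1) g k ^ lam * (b ^ (n + 1) - b ^ n : ℝ) =
      g ^ lam * weightConst b α lam * (1 - (b : ℝ) ^ (1 - (2 * α + 1) * lam)) *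
        ((b : ℝ) ^ (1 - (2 * α + 1) * lam)) ^ n := by
  have hb2 : (2 : ℝ) ≤ b := by exact_mod_cast hb
  have hb0 : (0 : ℝ) < b := by linarith
  have hb1 : (0 : ℝ) < b - 1 := by linarith
  rw [Finset.mem_Ico] at hk
  have hk0 : k ≠ 0 := fun h => by
    have : 0 < b ^ n := by positivity
    omega
  have hlog : Nat.log b k = n := (Nat.log_eq_iff (by right; exact ⟨by omega, hk0⟩)).2 hk
  rw [rOne, if_neg hk0, Nat.length_digits b k (by omega) hk0, hlog]
  have hrho : (b : ℝ) ^ (1 - (2 * α + 1) * lam) < 1 :=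
    Real.rpow_lt_one_of_one_lt_of_neg (by linarith) (by linarith)
  set ρ := (b : ℝ) ^ (1 - (2 * α + 1) * lam) with hρ
  have h1 : (b : ℝ) ^ (1 - lam) = (b : ℝ) ^ (2 * α * lam) * ρ := by
    rw [hρ, ← Real.rpow_add hb0]; congr 1; ring
  have hA : (0 : ℝ) < (b : ℝ) ^ (2 * α * lam) := by positivity
  have h2 : weightConst b α lam * (1 - ρ) =
      ((b : ℝ) - 1) ^ (1 - lam) * ((b : ℝ) ^ (2 * α * lam))⁻¹ := by
    rw [weightConst, h1]
    have : 1 - ρ ≠ 0 := by linarith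
    field_simp
  rw [mul_assoc (g ^ lam), h2, Real.mul_rpow hg (by positivity),
    Real.div_rpow hb0.le (by positivity), Real.mul_rpow hb1.le (by positivity), ← Real.rpow_mul hb0.le,
    Real.rpow_sub hb1, Real.rpow_one, pow_succ, ← Real.rpow_natCast, ← Real.rpow_natCast, hρ,
    ← Real.rpow_mul hb0.le, ← Real.rpow_neg hb0.le]
  -- Balance of exponents of b: λ - (2α+1)(n+1)λ + n = -2αλ + (1-(2α+1)λ)n.
  have h3 : (b : ℝ) ^ lam = (b : ℝ) ^ ((2 * α + 1) * ((n + 1 : ℕ) : ℝ) * lam) *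
      ((b : ℝ) ^ (-(n : ℝ)) * ((b : ℝ) ^ (-(2 * α * lam)) *
        (b : ℝ) ^ ((1 - (2 * α + 1) * lam) * (n : ℝ)))) := by
    simp only [← Real.rpow_add hb0]
    congr 1
    push_cast
    ring
  rw [h3, Real.rpow_neg hb0.le (n : ℝ)]
  field_simp

theorem sum_Ico_rOne_rpow {b : ℕ} (hb : 2 ≤ b) (α : ℝ) {g : ℝ} (hg : 0 ≤ g) {lam : ℝ}
    (hlam : 1 < (2 * α + 1) * lam) (n : ℕ) :
    ∑ k ∈ Finset.Ico 1 (b ^ n), rOne b (2 * α + 1) g k ^ lam =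
      g ^ lam * weightConst b α lam * (1 - ((b : ℝ) ^ (1 - (2 * α + 1) * lam)) ^ n) := by
  induction n with
  | zero => simp
  | succ n ih =>
    have h1 : 1 ≤ b ^ n := Nat.one_le_pow _ _ (by omega)
    have h2 : b ^ n ≤ b ^ (n + 1) := Nat.pow_le_pow_right (by omega) (by omega)
    have h3 : b ^ n < b ^ (n + 1) := Nat.pow_lt_pow_right (by omega) (by omega)
    have h4 : (0 : ℝ) < b ^ (n + 1) - b ^ n := by
      rw [sub_pos]; exact_mod_cast h3
    rw [← Finset.sum_Ico_consecutive _ h1 h2, ih,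
      Finset.sum_congr rfl fun k hk => (eq_div_iff h4.ne').2 (rOne_rpow_of_mem_Ico hb α hg hlam hk),
      Finset.sum_const, Nat.card_Ico, nsmul_eq_mul, Nat.cast_sub h2]
    push_cast
    field_simp
    ring

theorem weightConst_nonneg {b : ℕ} (hb : 2 ≤ b) {α lam : ℝ}
    (hlam : 1 < (2 * α + 1) * lam) : 0 ≤ weightConst b α lam := by
  have hb2 : (2 : ℝ) ≤ b := by exact_mod_cast hb
  have : (b : ℝ) ^ (1 - lam) ≤ (b : ℝ) ^ (2 * α * lam) :=
    Real.rpow_le_rpow_of_exponent_le (by linarith) (by linarith)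
  exact div_nonneg (Real.rpow_nonneg (by linarith) _) (by linarith)

theorem tsum_rOne_rpow_le {b : ℕ} (hb : 2 ≤ b) (α : ℝ) {g : ℝ} (hg : 0 ≤ g) {lam : ℝ}
    (hlam0 : 0 ≤ lam) (hlam : 1 < (2 * α + 1) * lam) :
    ∑' n : ℕ, ENNReal.ofReal (rOne b (2 * α + 1) g (n + 1)) ^ lam ≤
      ENNReal.ofReal (g ^ lam * weightConst b α lam) := by
  -- Partial sums of length b^n - 1 consist of complete digit blocks, since the summation starts at
  -- k = 1.
  have hN : Filter.Tendsto (fun n : ℕ => b ^ n - 1) Filter.atTop Filter.atTop :=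
    (Filter.tendsto_sub_atTop_nat 1).comp (tendsto_pow_atTop_atTop_of_one_lt (by omega))
  rw [ENNReal.tsum_eq_iSup_nat' hN]
  refine iSup_le fun n => ?_
  have h0 : ∀ k, 0 ≤ rOne b (2 * α + 1) g k := rOne_nonneg hb _ hg
  simp only [ENNReal.ofReal_rpow_of_nonneg (h0 _) hlam0]
  rw [← ENNReal.ofReal_sum_of_nonneg fun i _ => Real.rpow_nonneg (h0 _) _]
  refine ENNReal.ofReal_le_ofReal ?_
  have h1 := sum_Ico_rOne_rpow hb α hg hlam n
  rw [Finset.sum_Ico_eq_sum_range] at h1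
  simp only [add_comm 1] at h1
  rw [h1]
  refine mul_le_of_le_one_right
    (mul_nonneg (Real.rpow_nonneg hg _) (weightConst_nonneg hb hlam)) ?_
  have : (0 : ℝ) ≤ ((b : ℝ) ^ (1 - (2 * α + 1) * lam)) ^ n := by positivity
  linarith

theorem tsum_dvd_succ (N : ℕ) (hN : 0 < N) (f : ℕ → ENNReal) :
    ∑' n : ℕ, (if N ∣ n + 1 then f (n + 1) else 0) = ∑' l : ℕ, f (N * (l + 1)) := by
  have hsub : ∀ l, N * (l + 1) - 1 + 1 = N * (l + 1) := fun l =>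
    Nat.sub_add_cancel (Nat.mul_pos hN l.succ_pos)
  have hinj : Function.Injective fun l : ℕ => N * (l + 1) - 1 := by
    intro x y hxy
    have h : N * (x + 1) = N * (y + 1) := by rw [← hsub x, ← hsub y]; exact congrArg (· + 1) hxy
    have := Nat.eq_of_mul_eq_mul_left hN h
    omega
  rw [← hinj.tsum_eq (f := fun n => if N ∣ n + 1 then f (n + 1) else 0)]
  · refine tsum_congr fun l => ?_
    simp [hsub]
  · intro n hn
    rw [Function.mem_support] at hn
    have hd : N ∣ n + 1 := by
      by_contra h
      exact hn (if_neg h)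
    obtain ⟨c, hc⟩ := hd
    refine ⟨c - 1, ?_⟩
    have hc0 : 0 < c := Nat.pos_of_ne_zero (by rintro rfl; simp at hc)
    simp only [Nat.sub_add_cancel hc0, ← hc, Nat.add_sub_cancel]

/-- Multiplying the index by b^m scales each term by b^(-(2α+1)λm) ≤ b^(-m), which pays for the
factor b^m - 1. -/
theorem tsum_dvd_rOne_rpow_le {b : ℕ} (hb : 2 ≤ b) (α : ℝ) {g : ℝ} (hg : 0 ≤ g) {lam : ℝ}
    (hlam0 : 0 ≤ lam) (hlam : 1 < (2 * α + 1) * lam) (m : ℕ) :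
    ((b ^ m - 1 : ℕ) : ENNReal) * ∑' n : ℕ, (if b ^ m ∣ n + 1 then
        ENNReal.ofReal (rOne b (2 * α + 1) g (n + 1)) ^ lam else 0) ≤
      ENNReal.ofReal (g ^ lam * weightConst b α lam) := by
  have hb2 : (2 : ℝ) ≤ b := by exact_mod_cast hb
  have hb0 : (0 : ℝ) < b := by linarith
  rw [tsum_dvd_succ (b ^ m) (by positivity)
    fun k => ENNReal.ofReal (rOne b (2 * α + 1) g k) ^ lam]
  have h1 : ∀ l : ℕ, ENNReal.ofReal (rOne b (2 * α + 1) g (b ^ m * (l + 1))) ^ lam =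
      ENNReal.ofReal (((b : ℝ) ^ ((2 * α + 1) * lam * m))⁻¹) *
        ENNReal.ofReal (rOne b (2 * α + 1) g (l + 1)) ^ lam := by
    intro l
    rw [rOne_pow_mul hb _ _ _ l.succ_pos, ENNReal.ofReal_mul (by positivity),
      ENNReal.mul_rpow_of_nonneg _ _ hlam0, ENNReal.ofReal_rpow_of_nonneg (by positivity) hlam0,
      Real.inv_rpow (by positivity), ← Real.rpow_mul hb0.le, mul_right_comm]
  rw [tsum_congr h1, ENNReal.tsum_mul_left, ← mul_assoc]
  refine (mul_le_of_le_one_left (zero_le) ?_).trans (tsum_rOne_rpow_le hb α hg hlam0 hlam)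
  rw [← ENNReal.ofReal_natCast, ← ENNReal.ofReal_mul (by positivity), ENNReal.ofReal_le_one,
    ← div_eq_mul_inv, div_le_one (by positivity)]
  calc ((b ^ m - 1 : ℕ) : ℝ) ≤ ((b ^ m : ℕ) : ℝ) := by exact_mod_cast Nat.sub_le _ _
    _ = (b : ℝ) ^ (m : ℝ) := by simp
    _ ≤ _ := Real.rpow_le_rpow_of_exponent_le (by linarith)
      (le_mul_of_one_le_left (Nat.cast_nonneg _) hlam.le)

/-! ### Truncated polynomials, the set R_{b,m} and counting solutions modulo p. -/

theorem trPoly_coeff (b m k r : ℕ) :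
    (trPoly b m k).coeff r = if r < m then ((k / b ^ r % b : ℕ) : ZMod b) else 0 := by
  simp [trPoly, Polynomial.coeff_X_pow]

theorem trPoly_degree_lt (b m k : ℕ) : (trPoly b m k).degree < m := by
  rw [Polynomial.degree_lt_iff_coeff_zero]
  intro r hr
  rw [trPoly_coeff, if_neg (by omega)]

theorem trPoly_eq_zero_iff {b : ℕ} (hb : 0 < b) (m k : ℕ) : trPoly b m k = 0 ↔ b ^ m ∣ k := by
  have hcoeff : ∀ r < m, (trPoly b m k).coeff r = 0 ↔ b ∣ k / b ^ r := by
    intro r hr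
    rw [trPoly_coeff, if_pos hr, ZMod.natCast_eq_zero_iff, Nat.dvd_mod_iff (dvd_refl b)]
  constructor
  · intro h
    have key : ∀ r ≤ m, b ^ r ∣ k := by
      intro r
      induction r with
      | zero => simp
      | succ r ih =>
        intro hr
        have h1 := (hcoeff r hr).1 (by simp [h])
        rw [pow_succ]
        obtain ⟨l, rfl⟩ := ih (by omega)
        rw [Nat.mul_div_cancel_left _ (by positivity)] at h1
        exact Nat.mul_dvd_mul_left _ h1
    exact key m le_rfl
  · intro h
    ext r
    by_cases hr : r < m
    · rw [Polynomial.coeff_zero, hcoeff r hr]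
      refine Nat.dvd_div_of_mul_dvd (dvd_trans ?_ h)
      rw [← pow_succ]
      exact pow_dvd_pow _ hr
    · rw [trPoly_coeff, if_neg hr, Polynomial.coeff_zero]

theorem trPoly_zero {b : ℕ} (hb : 0 < b) (m : ℕ) : trPoly b m 0 = 0 :=
  (trPoly_eq_zero_iff hb m 0).2 (dvd_zero _)

theorem dvd_trPoly_iff {b : ℕ} [Fact b.Prime] (p : (ZMod b)[X]) (k : ℕ) :
    p ∣ trPoly b p.natDegree k ↔ b ^ p.natDegree ∣ k := by
  rw [← trPoly_eq_zero_iff (Fact.out : b.Prime).pos]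
  constructor
  · intro h
    by_cases hp : p = 0
    · subst hp
      exact zero_dvd_iff.1 h
    · refine Polynomial.eq_zero_of_dvd_of_degree_lt h ?_
      rw [Polynomial.degree_eq_natDegree hp]
      exact trPoly_degree_lt _ _ _
  · intro h
    rw [h]
    exact dvd_zero _

theorem not_dvd_of_mem_R {b : ℕ} [Fact b.Prime] {p g : (ZMod b)[X]}
    (hg : g ∈ R b p.natDegree) : ¬ p ∣ g := by
  intro h
  refine hg.2 (Polynomial.eq_zero_of_dvd_of_degree_lt h ?_)
  by_cases hp : p = 0
  · subst hp
    exact absurd (zero_dvd_iff.1 h) hg.2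
  · rw [Polynomial.degree_eq_natDegree hp]
    exact hg.1

theorem R_eq (b m : ℕ) :
    R b m = (Polynomial.degreeLT (ZMod b) m : Set (ZMod b)[X]) \ {0} := by
  ext g
  simp [R, Polynomial.mem_degreeLT]

theorem R_finite (b m : ℕ) [Fact b.Prime] : (R b m).Finite := by
  have : Finite (Polynomial.degreeLT (ZMod b) m) :=
    Finite.of_equiv _ (Polynomial.degreeLTEquiv (ZMod b) m).symm.toEquiv
  rw [R_eq]
  exact (Set.toFinite (Polynomial.degreeLT (ZMod b) m : Set (ZMod b)[X])).sdiff

theorem R_ncard (b m : ℕ) [Fact b.Prime] : (R b m).ncard = b ^ m - 1 := by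
  rw [R_eq, Set.ncard_sdiff_singleton_of_mem (Submodule.zero_mem _)]
  congr 1
  rw [← Nat.card_coe_set_eq]
  refine (Nat.card_congr (Polynomial.degreeLTEquiv (ZMod b) m).toEquiv).trans ?_
  simp

theorem card_filter_dvd_le {b : ℕ} [Fact b.Prime] {p : (ZMod b)[X]} (hp : Irreducible p)
    (T : Finset (ZMod b)[X]) (hT : ∀ g, g ∈ T ↔ g ∈ R b p.natDegree)
    (S : (ZMod b)[X]) (n : ℕ) [DecidablePred fun g => p ∣ S + trPoly b p.natDegree n * g]
    [Decidable (p ∣ S)] [Decidable (b ^ p.natDegree ∣ n)] :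
    (T.filter fun g => p ∣ S + trPoly b p.natDegree n * g).card ≤
      if p ∣ S then (if b ^ p.natDegree ∣ n then T.card else 0) else 1 := by
  by_cases hn : b ^ p.natDegree ∣ n
  · have h0 := (trPoly_eq_zero_iff (Fact.out : b.Prime).pos p.natDegree n).2 hn
    simp only [h0, zero_mul, add_zero, if_pos hn]
    split_ifs with hS
    · exact Finset.card_filter_le _ _
    · simp [hS]
  · have h0 : ¬ p ∣ trPoly b p.natDegree n := fun h => hn ((dvd_trPoly_iff p n).1 h)
    rw [if_neg hn]
    split_ifs with hS
    · rw [Nat.le_zero, Finset.card_eq_zero, Finset.filter_eq_empty_iff]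
      intro g hg hdvd
      rcases hp.prime.dvd_or_dvd ((dvd_add_right hS).1 hdvd) with h | h
      · exact h0 h
      · exact not_dvd_of_mem_R ((hT g).1 hg) h
    · rw [Finset.card_le_one]
      intro g hg g' hg'
      rw [Finset.mem_filter] at hg hg'
      have h1 : p ∣ trPoly b p.natDegree n * (g - g') := by
        have := dvd_sub hg.2 hg'.2
        rwa [add_sub_add_left_eq_sub, ← mul_sub] at this
      have h2 := (hp.prime.dvd_or_dvd h1).resolve_left h0
      refine sub_eq_zero.1 (Polynomial.eq_zero_of_dvd_of_degree_lt h2 ?_)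
      rw [Polynomial.degree_eq_natDegree hp.ne_zero]
      exact (Polynomial.degree_sub_le _ _).trans_lt
        (max_lt ((hT g).1 hg.1).1 ((hT g').1 hg'.1).1)

/-! ### Splitting off the last coordinate. -/

open scoped Classical in
theorem critB_eq_tsum_ite {b s : ℕ} (p : (ZMod b)[X]) (q : Fin s → (ZMod b)[X]) (α : ℝ)
    (γ : ℕ → ℝ) :
    critB p q α γ = ∑' k : Fin s → ℕ, if p ∣ ∑ j, trPoly b p.natDegree (k j) * q j ∧ k ≠ 0 then
      ENNReal.ofReal (rProd b (2 * α + 1) γ k) else 0 := by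
  rw [critB, tsum_subtype (dualLattice p q \ {0})
    fun k => ENNReal.ofReal (rProd b (2 * α + 1) γ k)]
  refine tsum_congr fun k => ?_
  rw [Set.indicator_apply]
  rfl

theorem rProd_snoc (b : ℕ) (β : ℝ) (γ : ℕ → ℝ) {d : ℕ} (k : Fin d → ℕ) (n : ℕ) :
    rProd b β γ (Fin.snoc (α := fun _ => ℕ) k n) = rProd b β γ k * rOne b β (γ d) n := by
  simp [rProd, Fin.prod_univ_castSucc]

theorem rProd_nonneg {b : ℕ} (hb : 2 ≤ b) (β : ℝ) {γ : ℕ → ℝ} (hγ : ∀ j, 0 ≤ γ j) {d : ℕ}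
    (k : Fin d → ℕ) : 0 ≤ rProd b β γ k :=
  Finset.prod_nonneg fun _ _ => rOne_nonneg hb _ (hγ _) _

theorem tsum_snoc {d : ℕ} (f : (Fin (d + 1) → ℕ) → ENNReal) :
    ∑' k, f k = ∑' (k : Fin d → ℕ),
      (f (Fin.snoc (α := fun _ => ℕ) k 0) + ∑' n, f (Fin.snoc (α := fun _ => ℕ) k (n + 1))) := by
  rw [← (Fin.snocEquiv fun _ => ℕ).tsum_eq, ENNReal.tsum_prod', ENNReal.tsum_comm]
  refine tsum_congr fun k => ?_
  rw [tsum_eq_zero_add' ENNReal.summable]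
  rfl

theorem snoc_eq_zero_iff {d : ℕ} (k : Fin d → ℕ) (n : ℕ) :
    Fin.snoc (α := fun _ => ℕ) k n = 0 ↔ k = 0 ∧ n = 0 := by
  constructor
  · intro h
    constructor
    · funext i
      simpa using congrFun h i.castSucc
    · simpa using congrFun h (Fin.last d)
  · rintro ⟨rfl, rfl⟩
    funext i
    refine Fin.lastCases ?_ (fun i => ?_) i <;> simp

open scoped Classical in
-- Indices with last coordinate 0 reproduce the criterion of q. For the others the condition of
-- being nonzero is automatic and drops out.
theorem critB_snoc {b : ℕ} (hb : 2 ≤ b) {d : ℕ} (p : (ZMod b)[X]) (q : Fin d → (ZMod b)[X])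
    (g : (ZMod b)[X]) (α : ℝ) {γ : ℕ → ℝ} (hγ : ∀ j, 0 ≤ γ j) :
    critB p (Fin.snoc (α := fun _ => (ZMod b)[X]) q g) α γ = critB p q α γ +
      ∑' (k : Fin d → ℕ) (n : ℕ),
        if p ∣ (∑ j, trPoly b p.natDegree (k j) * q j) + trPoly b p.natDegree (n + 1) * g then
          ENNReal.ofReal (rProd b (2 * α + 1) γ k) *
            ENNReal.ofReal (rOne b (2 * α + 1) (γ d) (n + 1)) else 0 := by
  rw [critB_eq_tsum_ite, critB_eq_tsum_ite, tsum_snoc, ENNReal.tsum_add]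
  congr 1
  · refine tsum_congr fun k => ?_
    rw [rProd_snoc, Fin.sum_univ_castSucc]
    simp [snoc_eq_zero_iff, trPoly_zero (by omega : 0 < b), rOne]
  · refine tsum_congr fun k => tsum_congr fun n => ?_
    rw [rProd_snoc, Fin.sum_univ_castSucc, ENNReal.ofReal_mul (rProd_nonneg hb _ hγ _)]
    simp [snoc_eq_zero_iff]

theorem tsum_rProd_rpow_le {b : ℕ} (hb : 2 ≤ b) (α : ℝ) {γ : ℕ → ℝ} (hγ : ∀ j, 0 ≤ γ j) {lam : ℝ}
    (hlam0 : 0 ≤ lam) (hlam : 1 < (2 * α + 1) * lam) (d : ℕ) :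
    ∑' k : Fin d → ℕ, ENNReal.ofReal (rProd b (2 * α + 1) γ k) ^ lam ≤
      ∏ j ∈ Finset.range d, (1 + ENNReal.ofReal (γ j ^ lam * weightConst b α lam)) := by
  induction d with
  | zero => simp [rProd]
  | succ d ih =>
    have h : ∀ (k : Fin d → ℕ) (n : ℕ), ENNReal.ofReal (rProd b (2 * α + 1) γ
        (Fin.snoc (α := fun _ => ℕ) k n)) ^ lam = ENNReal.ofReal (rProd b (2 * α + 1) γ k) ^ lam *
          ENNReal.ofReal (rOne b (2 * α + 1) (γ d) n) ^ lam := by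
      intro k n
      rw [rProd_snoc, ENNReal.ofReal_mul (rProd_nonneg hb _ hγ _),
        ENNReal.mul_rpow_of_nonneg _ _ hlam0]
    rw [tsum_snoc, Finset.prod_range_succ]
    simp only [h, ENNReal.tsum_mul_left, ← mul_add, ENNReal.tsum_mul_right]
    refine mul_le_mul' ih ?_
    refine add_le_add (by simp [rOne]) (tsum_rOne_rpow_le hb α (hγ d) hlam0 hlam)

/-! ### The averaging induction. -/

open scoped Classical in
/-- Averaging over the last component of the generating vector. -/
theorem sum_tsum_ite_dvd_le {b : ℕ} [Fact b.Prime] {p : (ZMod b)[X]} (hp : Irreducible p)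
    (T : Finset (ZMod b)[X]) (hT : ∀ g, g ∈ T ↔ g ∈ R b p.natDegree) {d : ℕ}
    (q : Fin d → (ZMod b)[X]) (W : (Fin d → ℕ) → ENNReal) (w : ℕ → ENNReal) (x : ENNReal)
    (hx : ∑' n, w (n + 1) ≤ x)
    (hx' : (T.card : ENNReal) *
      ∑' n : ℕ, (if b ^ p.natDegree ∣ n + 1 then w (n + 1) else 0) ≤ x) :
    ∑ g ∈ T, ∑' (k : Fin d → ℕ) (n : ℕ),
        (if p ∣ (∑ j, trPoly b p.natDegree (k j) * q j) + trPoly b p.natDegree (n + 1) * g then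
          W k * w (n + 1) else 0) ≤ (∑' k, W k) * x := by
  rw [← Summable.tsum_finsetSum fun _ _ => ENNReal.summable, ← ENNReal.tsum_mul_right]
  refine ENNReal.tsum_le_tsum fun k => ?_
  rw [← Summable.tsum_finsetSum fun _ _ => ENNReal.summable]
  set S := ∑ j, trPoly b p.natDegree (k j) * q j
  have h1 : ∀ n : ℕ, ∑ g ∈ T, (if p ∣ S + trPoly b p.natDegree (n + 1) * g then
      W k * w (n + 1) else 0) ≤ W k * (if p ∣ S then (T.card : ENNReal) *
        (if b ^ p.natDegree ∣ n + 1 then w (n + 1) else 0) else w (n + 1)) := by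
    intro n
    rw [← Finset.sum_filter, Finset.sum_const, nsmul_eq_mul]
    have h2 : ((T.filter fun g => p ∣ S + trPoly b p.natDegree (n + 1) * g).card : ENNReal) ≤
        ((if p ∣ S then (if b ^ p.natDegree ∣ n + 1 then T.card else 0) else 1 : ℕ) : ENNReal) := by
      exact_mod_cast card_filter_dvd_le hp T hT S (n + 1)
    refine (mul_le_mul_left h2 _).trans (le_of_eq ?_)
    split_ifs <;> simp [mul_left_comm]
  refine (ENNReal.tsum_le_tsum h1).trans ?_
  rw [ENNReal.tsum_mul_left]
  gcongr
  -- For p ∣ S only multiples of b^m survive, each counted `T.card` times; otherwise each n is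
  -- counted at most once.
  split_ifs
  · rw [ENNReal.tsum_mul_left]
    exact hx'
  · exact hx

theorem critB_snoc_rpow_le {b : ℕ} (hb : 2 ≤ b) {d : ℕ} (p : (ZMod b)[X])
    (q : Fin d → (ZMod b)[X]) (g : (ZMod b)[X]) (α : ℝ) {γ : ℕ → ℝ} (hγ : ∀ j, 0 ≤ γ j)
    {lam : ℝ} (h0 : 0 < lam) (h1 : lam ≤ 1)
    [∀ f : (ZMod b)[X], Decidable (p ∣ f)] :
    critB p (Fin.snoc (α := fun _ => (ZMod b)[X]) q g) α γ ^ lam ≤ critB p q α γ ^ lam +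
      ∑' (k : Fin d → ℕ) (n : ℕ),
        if p ∣ (∑ j, trPoly b p.natDegree (k j) * q j) + trPoly b p.natDegree (n + 1) * g then
          ENNReal.ofReal (rProd b (2 * α + 1) γ k) ^ lam *
            ENNReal.ofReal (rOne b (2 * α + 1) (γ d) (n + 1)) ^ lam else 0 := by
  rw [critB_snoc hb p q g α hγ]
  refine (ENNReal.rpow_add_le_add_rpow _ _ h0.le h1).trans (add_le_add le_rfl ?_)
  refine (ENNReal.rpow_tsum_le_tsum_rpow _ h0 h1).trans (ENNReal.tsum_le_tsum fun k => ?_)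
  refine (ENNReal.rpow_tsum_le_tsum_rpow _ h0 h1).trans (ENNReal.tsum_le_tsum fun n => ?_)
  split_ifs
  · rw [ENNReal.mul_rpow_of_nonneg _ _ h0.le]
  · simp [h0]

/-- In dimension one p ∤ g, so g cancels from the congruence. Hence the first component minimizes
trivially and the induction can start at d = 0. -/
theorem critB_snoc_finZero {b : ℕ} [Fact b.Prime] {p : (ZMod b)[X]} (hp : Irreducible p)
    (q : Fin 0 → (ZMod b)[X]) {g g' : (ZMod b)[X]} (hg : g ∈ R b p.natDegree)
    (hg' : g' ∈ R b p.natDegree) (α : ℝ) {γ : ℕ → ℝ} (hγ : ∀ j, 0 ≤ γ j) :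
    critB p (Fin.snoc (α := fun _ => (ZMod b)[X]) q g) α γ =
      critB p (Fin.snoc (α := fun _ => (ZMod b)[X]) q g') α γ := by
  classical
  have hb : 2 ≤ b := (Fact.out : b.Prime).two_le
  rw [critB_snoc hb p q g α hγ, critB_snoc hb p q g' α hγ]
  have h : ∀ f ∈ R b p.natDegree, ∀ (k : Fin 0 → ℕ) (n : ℕ),
      p ∣ (∑ j, trPoly b p.natDegree (k j) * q j) + trPoly b p.natDegree (n + 1) * f ↔
        p ∣ trPoly b p.natDegree (n + 1) := by
    intro f hf k n
    rw [Fin.sum_univ_zero, zero_add, hp.prime.dvd_mul, or_iff_left (not_dvd_of_mem_R hf)]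
  congr 1
  exact tsum_congr fun k => tsum_congr fun n =>
    if_congr ((h g hg k n).trans (h g' hg' k n).symm) rfl rfl

theorem card_mul_critB_rpow_le {b : ℕ} [Fact b.Prime] {p : (ZMod b)[X]} (hp : Irreducible p)
    {α : ℝ} {γ : ℕ → ℝ} (hγ : ∀ j, 0 ≤ γ j) {s : ℕ} {q : Fin s → (ZMod b)[X]}
    (hq : IsCBC p α γ q) {lam : ℝ} (h0 : 0 < lam) (h1 : lam ≤ 1)
    (hlam : 1 < (2 * α + 1) * lam) (d : ℕ) (hd : d ≤ s) :
    ((b ^ p.natDegree - 1 : ℕ) : ENNReal) *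
        critB p (fun i : Fin d => q (Fin.castLE hd i)) α γ ^ lam ≤
      ∏ j ∈ Finset.range d, (1 + ENNReal.ofReal (γ j ^ lam * weightConst b α lam)) := by
  classical
  have hb : 2 ≤ b := (Fact.out : b.Prime).two_le
  obtain ⟨T, hT⟩ := (R_finite b p.natDegree).exists_finset
  have hcard : T.card = b ^ p.natDegree - 1 := by
    rw [← R_ncard, ← Set.ncard_coe_finset]
    congr 1
    ext g
    simp [hT]
  induction d with
  | zero =>
    have : critB p (fun i : Fin 0 => q (Fin.castLE hd i)) α γ = 0 := by
      rw [critB_eq_tsum_ite, ENNReal.tsum_eq_zero]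
      exact fun k => if_neg fun h => h.2 (Subsingleton.elim _ _)
    simp [this, h0]
  | succ d ih =>
    have hds : d < s := hd
    have ih := ih hds.le
    set q' := fun i : Fin d => q (Fin.castLE hds.le i) with hq'
    have hsnoc : (fun i : Fin (d + 1) => q (Fin.castLE hd i)) =
        Fin.snoc (α := fun _ => (ZMod b)[X]) q' (q ⟨d, hds⟩) := by
      funext i
      refine Fin.lastCases ?_ (fun i => ?_) i
      · rw [Fin.snoc_last]; rfl
      · rw [Fin.snoc_castSucc]; rfl
    have hmin : ∀ g ∈ T, critB p (Fin.snoc (α := fun _ => (ZMod b)[X]) q' (q ⟨d, hds⟩)) α γ ≤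
        critB p (Fin.snoc (α := fun _ => (ZMod b)[X]) q' g) α γ := by
      intro g hg
      rcases Nat.eq_zero_or_pos d with rfl | hd0
      · exact (critB_snoc_finZero hp q' (hq.mem _) ((hT g).1 hg) α hγ).le
      · exact hq.minimal d hds hd0 g ((hT g).1 hg)
    rw [hsnoc, Finset.prod_range_succ, mul_add, mul_one, ← hcard, ← nsmul_eq_mul,
      ← Finset.sum_const]
    calc ∑ _g ∈ T, critB p (Fin.snoc (α := fun _ => (ZMod b)[X]) q' (q ⟨d, hds⟩)) α γ ^ lam
        ≤ ∑ g ∈ T, critB p (Fin.snoc (α := fun _ => (ZMod b)[X]) q' g) α γ ^ lam :=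
          Finset.sum_le_sum fun g hg => ENNReal.rpow_le_rpow (hmin g hg) h0.le
      _ ≤ _ := Finset.sum_le_sum fun g _ => critB_snoc_rpow_le hb p q' g α hγ h0 h1
      _ ≤ _ := by
        rw [Finset.sum_add_distrib]
        -- With P the product of the first d factors and 1 + x the next one, the two sums are
        -- bounded by P and P * x.
        refine add_le_add ?_ ?_
        · rw [Finset.sum_const, nsmul_eq_mul, hcard]
          exact ih
        · refine (sum_tsum_ite_dvd_le hp T hT q'
            (fun k => ENNReal.ofReal (rProd b (2 * α + 1) γ k) ^ lam)
            (fun n => ENNReal.ofReal (rOne b (2 * α + 1) (γ d) n) ^ lam) _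
            (tsum_rOne_rpow_le hb α (hγ d) h0.le hlam) ?_).trans ?_
          · rw [hcard]
            exact tsum_dvd_rOne_rpow_le hb α (hγ d) h0.le hlam p.natDegree
          · exact mul_le_mul_left (tsum_rProd_rpow_le hb α hγ h0.le hlam d) _

/-! ### The constants c_{s,α,γ,δ} and the infinite product. -/

theorem weightConst_le_constC (b : ℕ) (α lam : ℝ) : weightConst b α lam ≤ constC b α lam :=
  le_max_right _ _

theorem constC_pos {b : ℕ} (hb : 2 ≤ b) {α : ℝ} (hα : 0 < α) (lam : ℝ) : 0 < constC b α lam := by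
  have hb1 : (1 : ℝ) < b := by exact_mod_cast (by omega : 1 < b)
  have : (0 : ℝ) < (b : ℝ) ^ (2 * α) - 1 :=
    sub_pos.2 (Real.one_lt_rpow hb1 (by linarith))
  exact lt_of_lt_of_le (by positivity) (le_max_left _ _)

theorem one_le_factor {b : ℕ} (hb : 2 ≤ b) {α δ g : ℝ} (hα : 0 < α) (hδ : δ ≤ 2 * α)
    (hg : 0 ≤ g) : 1 ≤ factor b α δ g := by
  refine Real.one_le_rpow ?_ (by linarith)
  have := constC_pos hb hα (1 / (2 * α + 1 - δ))
  have : 0 ≤ g ^ (1 / (2 * α + 1 - δ)) * constC b α (1 / (2 * α + 1 - δ)) := by positivity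
  linarith

theorem critB_le_constc {b : ℕ} (hb : b.Prime) {α : ℝ} (hα : 0 < α) {γ : ℕ → ℝ}
    (hγ : ∀ j, 0 ≤ γ j) {δ : ℝ} (hδ0 : 0 < δ) (hδ : δ ≤ 2 * α) {s m : ℕ} (hm : 1 ≤ m)
    {p : (ZMod b)[X]} (hp : Irreducible p) (hpm : p.natDegree = m) {q : Fin s → (ZMod b)[X]}
    (hq : IsCBC p α γ q) :
    critB p q α γ ≤ ENNReal.ofReal
      (constc b s α γ δ * ((b : ℝ) ^ m - 1) ^ (-(2 * α + 1) + δ)) := by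
  have := Fact.mk hb
  have hb2 := hb.two_le
  set t := 2 * α + 1 - δ with ht
  have ht1 : 1 ≤ t := by linarith
  have ht0 : 0 < t := by linarith
  have hlam0 : 0 < 1 / t := by positivity
  have hlam1 : 1 / t ≤ 1 := (div_le_one ht0).2 ht1
  have hlam : 1 < (2 * α + 1) * (1 / t) := by
    rw [mul_one_div, one_lt_div ht0]
    linarith
  have key := card_mul_critB_rpow_le hp hγ hq hlam0 hlam1 hlam s le_rfl
  rw [hpm] at key
  have hN : 1 < b ^ m := Nat.one_lt_pow (by omega) (by omega)
  have hN0 : (0 : ℝ) < (b : ℝ) ^ m - 1 := by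
    rw [sub_pos]
    exact_mod_cast hN
  have hNcast : ((b ^ m - 1 : ℕ) : ENNReal) = ENNReal.ofReal ((b : ℝ) ^ m - 1) := by
    rw [← ENNReal.ofReal_natCast, Nat.cast_sub hN.le]
    simp
  have hx : ∀ j, 0 ≤ γ j ^ (1 / t) * constC b α (1 / t) := fun j =>
    mul_nonneg (Real.rpow_nonneg (hγ j) _) (constC_pos hb2 hα _).le
  set P := ∏ j ∈ Finset.range s, (1 + γ j ^ (1 / t) * constC b α (1 / t)) with hP
  have hP0 : 0 ≤ P := Finset.prod_nonneg fun j _ => by linarith [hx j]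
  have hprod : ∏ j ∈ Finset.range s, (1 + ENNReal.ofReal (γ j ^ (1 / t) *
      weightConst b α (1 / t))) ≤ ENNReal.ofReal P := by
    rw [hP, ENNReal.ofReal_prod_of_nonneg fun j _ => by linarith [hx j]]
    refine Finset.prod_le_prod' fun j _ => ?_
    rw [ENNReal.ofReal_add zero_le_one (hx j), ENNReal.ofReal_one]
    gcongr
    · exact Real.rpow_nonneg (hγ j) _
    · exact weightConst_le_constC _ _ _
  have hle : critB p q α γ ^ (1 / t) ≤ ENNReal.ofReal (P / ((b : ℝ) ^ m - 1)) := by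
    rw [ENNReal.ofReal_div_of_pos hN0, ENNReal.le_div_iff_mul_le
      (Or.inl (by simpa using hN0)) (Or.inl ENNReal.ofReal_ne_top), mul_comm, ← hNcast]
    exact key.trans hprod
  have hc : constc b s α γ δ = P ^ t := by
    rw [hP, ← Real.finsetProd_rpow _ _ fun j _ => by linarith [hx j]]
    rfl
  rw [one_div, ENNReal.rpow_inv_le_iff ht0,
    ENNReal.ofReal_rpow_of_nonneg (by positivity) ht0.le] at hle
  refine hle.trans (le_of_eq ?_)
  rw [hc, Real.div_rpow hP0 hN0.le, div_eq_mul_inv, ← Real.rpow_neg hN0.le]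
  congr 3
  rw [ht]
  ring

theorem multipliable_factor {b : ℕ} (hb : 2 ≤ b) {α : ℝ} (hα : 0 < α) {γ : ℕ → ℝ}
    (hγ : ∀ j, 0 ≤ γ j) {δ : ℝ} (hδ : δ ≤ 2 * α)
    (hsum : Summable fun j : ℕ => γ j ^ (1 / (2 * α + 1 - δ))) :
    Multipliable fun j : ℕ => factor b α δ (γ j) := by
  have h1 : ∀ j, 1 ≤ factor b α δ (γ j) := fun j => one_le_factor hb hα hδ (hγ j)
  refine Real.multipliable_of_summable_log (fun j => by linarith [h1 j]) ?_
  refine Summable.of_nonneg_of_le (fun j => Real.log_nonneg (h1 j)) (fun j => ?_)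
    ((hsum.mul_right (constC b α (1 / (2 * α + 1 - δ)))).mul_left (2 * α + 1 - δ))
  have hx : 0 ≤ γ j ^ (1 / (2 * α + 1 - δ)) * constC b α (1 / (2 * α + 1 - δ)) :=
    mul_nonneg (Real.rpow_nonneg (hγ j) _) (constC_pos hb hα _).le
  rw [factor, Real.log_rpow (by linarith)]
  refine mul_le_mul_of_nonneg_left ?_ (by linarith)
  linarith [Real.log_le_sub_one_of_pos (by linarith :
    0 < 1 + γ j ^ (1 / (2 * α + 1 - δ)) * constC b α (1 / (2 * α + 1 - δ)))]

theorem constc_le_constcInf {b : ℕ} (hb : 2 ≤ b) {α : ℝ} (hα : 0 < α) {γ : ℕ → ℝ}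
    (hγ : ∀ j, 0 ≤ γ j) {δ : ℝ} (hδ : δ ≤ 2 * α)
    (hmul : Multipliable fun j : ℕ => factor b α δ (γ j)) (s : ℕ) :
    constc b s α γ δ ≤ constcInf b α γ δ := by
  have h1 : ∀ j, 1 ≤ factor b α δ (γ j) := fun j => one_le_factor hb hα hδ (hγ j)
  refine ge_of_tendsto hmul.hasProd.tendsto_prod_nat
    ((Filter.eventually_ge_atTop s).mono fun n hn => ?_)
  exact Finset.prod_le_prod_of_subset_of_one_le (Finset.range_mono hn)
    (fun j _ => by linarith [h1 j]) fun j _ _ => h1 j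

/-! ### Polynomial dependence on the dimension. -/

/-- Here λ = 1, and the two entries of the maximum in `constC` coincide. -/
theorem factor_two_mul (b : ℕ) (α g : ℝ) :
    factor b α (2 * α) g = 1 + g * (1 / ((b : ℝ) ^ (2 * α) - 1)) := by
  simp [factor, constC]

/-- The polynomial growth of `c_{s,α,γ,2α}` in `s`, uniformly in `b`. -/
theorem exists_constc_le {α : ℝ} (hα : 0 < α) {γ : ℕ → ℝ} (hγ : ∀ j, 0 ≤ γ j) {A : ℝ}
    (hA : Filter.limsup
      (fun s : ℕ => (((∑ j ∈ Finset.range s, γ j) / Real.log (s : ℝ) : ℝ) : EReal))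
      Filter.atTop = (A : EReal)) {η : ℝ} (hη : 0 < η) :
    ∃ c : ℝ, 0 < c ∧ ∀ b : ℕ, 2 ≤ b → ∀ s : ℕ, 1 ≤ s →
      constc b s α γ (2 * α) ≤ c * (s : ℝ) ^ ((A + η) / ((b : ℝ) ^ (2 * α) - 1)) := by
  have hA0 : 0 ≤ A := by
    have : (0 : EReal) ≤ (A : EReal) := by
      rw [← hA]
      refine Filter.le_limsup_of_frequently_le (Filter.Frequently.of_forall fun s => ?_)
      exact_mod_cast div_nonneg (Finset.sum_nonneg fun j _ => hγ j) (Real.log_natCast_nonneg s)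
    exact_mod_cast this
  have hev : ∀ᶠ s : ℕ in Filter.atTop,
      (((∑ j ∈ Finset.range s, γ j) / Real.log (s : ℝ) : ℝ) : EReal) < ((A + η : ℝ) : EReal) := by
    refine Filter.eventually_lt_of_limsup_lt ?_
    rw [hA]
    exact_mod_cast (by linarith : A < A + η)
  obtain ⟨s₀, hs₀⟩ := Filter.eventually_atTop.1 hev
  have hfac : ∀ b : ℕ, 2 ≤ b → (0 : ℝ) < (b : ℝ) ^ (2 * α) - 1 := fun b hb =>
    sub_pos.2 (Real.one_lt_rpow (by exact_mod_cast (by omega : 1 < b)) (by linarith))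
  have h1 : ∀ b : ℕ, 2 ≤ b → ∀ j, 1 ≤ factor b α (2 * α) (γ j) := fun b hb j =>
    one_le_factor hb hα le_rfl (hγ j)
  have hc1 : ∀ s, 1 ≤ constc 2 s α γ (2 * α) := fun s =>
    Finset.one_le_prod fun j _ => h1 2 le_rfl j
  -- From s₀ on the ratio is below A + η, and s ≥ 2 makes log s positive. Smaller s are covered by
  -- the product at s₁ for b = 2: factors decrease in b and are at least 1, so the constant is
  -- uniform in b.
  set s₁ := max s₀ 2
  refine ⟨constc 2 s₁ α γ (2 * α), by linarith [hc1 s₁], fun b hb s hs => ?_⟩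
  have hD := hfac b hb
  have hs1 : (1 : ℝ) ≤ s := by exact_mod_cast hs
  rcases le_total s₁ s with hle | hle
  · have hs2 : 2 ≤ s := (le_max_right _ _).trans hle
    have hlog : 0 < Real.log s := Real.log_pos (by exact_mod_cast (by omega : 1 < s))
    have hsum : (∑ j ∈ Finset.range s, γ j) / Real.log s < A + η := by
      exact_mod_cast hs₀ s ((le_max_left _ _).trans hle)
    rw [div_lt_iff₀ hlog] at hsum
    calc constc b s α γ (2 * α)
        = ∏ j ∈ Finset.range s, (1 + γ j * (1 / ((b : ℝ) ^ (2 * α) - 1))) :=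
          Finset.prod_congr rfl fun j _ => factor_two_mul b α (γ j)
      _ ≤ Real.exp (∑ j ∈ Finset.range s, γ j * (1 / ((b : ℝ) ^ (2 * α) - 1))) :=
          Real.prod_one_add_le_exp_sum _ fun j => mul_nonneg (hγ j) (by positivity)
      _ ≤ Real.exp (Real.log s * ((A + η) / ((b : ℝ) ^ (2 * α) - 1))) := by
          rw [← Finset.sum_mul, Real.exp_le_exp, mul_one_div, mul_div_assoc',
            mul_comm (Real.log _)]
          gcongr
      _ = (s : ℝ) ^ ((A + η) / ((b : ℝ) ^ (2 * α) - 1)) := by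
          rw [Real.rpow_def_of_pos (zero_lt_one.trans_le hs1)]
      _ ≤ _ := le_mul_of_one_le_left (by positivity) (hc1 s₁)
  · calc constc b s α γ (2 * α) ≤ constc 2 s α γ (2 * α) := by
          refine Finset.prod_le_prod (fun j _ => by linarith [h1 b hb j]) fun j _ => ?_
          rw [factor_two_mul, factor_two_mul]
          have := hfac 2 le_rfl
          have hb2 : ((2 : ℕ) : ℝ) ≤ b := by exact_mod_cast hb
          have hj := hγ j
          gcongr
      _ ≤ constc 2 s₁ α γ (2 * α) :=
          Finset.prod_le_prod_of_subset_of_one_le (Finset.range_mono hle)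
            (fun j _ => by linarith [h1 2 le_rfl j]) fun j _ _ => h1 2 le_rfl j
      _ ≤ _ := le_mul_of_one_le_right (by linarith [hc1 s₁])
          (Real.one_le_rpow hs1 (div_nonneg (by linarith) hD.le))

end PolyLattice

theorem corollary4p2 (α : ℝ) (hα0 : 0 < α) (hα1 : α ≤ 1)
    (γ : ℕ → ℝ) (hγ : ∀ j, 0 < γ j) (hγanti : Antitone γ) :
    -- part 1
    (∀ b : ℕ, b.Prime → ∀ δ : ℝ, 0 < δ → δ ≤ 2 * α →
      ∀ s m : ℕ, 1 ≤ s → 1 ≤ m → ∀ p : Polynomial (ZMod b), Irreducible p → p.natDegree = m →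
        ∀ q : Fin s → Polynomial (ZMod b), PolyLattice.IsCBC p α γ q →
          PolyLattice.critB p q α γ ≤ ENNReal.ofReal
            (PolyLattice.constc b s α γ δ * ((b : ℝ) ^ m - 1) ^ (-(2 * α + 1) + δ))) ∧
    -- part 2
    (∀ b : ℕ, b.Prime → ∀ δ : ℝ, 0 < δ → δ ≤ 2 * α →
      Summable (fun j : ℕ => γ j ^ (1 / (2 * α + 1 - δ))) →
        Multipliable (fun j : ℕ => PolyLattice.factor b α δ (γ j)) ∧
        (∀ s : ℕ, PolyLattice.constc b s α γ δ ≤ PolyLattice.constcInf b α γ δ) ∧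
        ∀ s m : ℕ, 1 ≤ s → 1 ≤ m → ∀ p : Polynomial (ZMod b), Irreducible p → p.natDegree = m →
          ∀ q : Fin s → Polynomial (ZMod b), PolyLattice.IsCBC p α γ q →
            PolyLattice.critB p q α γ ≤ ENNReal.ofReal
              (PolyLattice.constcInf b α γ δ * ((b : ℝ) ^ m - 1) ^ (-(2 * α + 1) + δ))) ∧
    -- part 3
    (∀ A : ℝ,
      Filter.limsup
        (fun s : ℕ => (((∑ j ∈ Finset.range s, γ j) / Real.log (s : ℝ) : ℝ) : EReal))
        Filter.atTop = (A : EReal) →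
      ∀ η : ℝ, 0 < η → ∃ c : ℝ, 0 < c ∧ ∀ b : ℕ, b.Prime → ∀ s : ℕ, 1 ≤ s →
        PolyLattice.constc b s α γ (2 * α) ≤
          c * ((b : ℝ) - 1) ^ (2 * α) * (s : ℝ) ^ ((A + η) / ((b : ℝ) ^ (2 * α) - 1)) ∧
        ∀ m : ℕ, 1 ≤ m → ∀ p : Polynomial (ZMod b), Irreducible p → p.natDegree = m →
          ∀ q : Fin s → Polynomial (ZMod b), PolyLattice.IsCBC p α γ q →
            PolyLattice.critB p q α γ ≤ ENNReal.ofReal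
              (c * (s : ℝ) ^ ((A + η) / ((b : ℝ) ^ (2 * α) - 1)) * ((b : ℝ) ^ m - 1)⁻¹)) := by
  have hγ0 : ∀ j, 0 ≤ γ j := fun j => (hγ j).le
  refine ⟨?_, ?_, ?_⟩
  · intro b hb δ hδ0 hδ s m _ hm p hp hpm q hq
    exact PolyLattice.critB_le_constc hb hα0 hγ0 hδ0 hδ hm hp hpm hq
  · intro b hb δ hδ0 hδ hsum
    have hmul := PolyLattice.multipliable_factor hb.two_le hα0 hγ0 hδ hsum
    have hle := PolyLattice.constc_le_constcInf hb.two_le hα0 hγ0 hδ hmul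
    refine ⟨hmul, hle, ?_⟩
    intro s m _ hm p hp hpm q hq
    refine (PolyLattice.critB_le_constc hb hα0 hγ0 hδ0 hδ hm hp hpm hq).trans
      (ENNReal.ofReal_le_ofReal (mul_le_mul_of_nonneg_right (hle s) (Real.rpow_nonneg ?_ _)))
    rw [sub_nonneg]
    exact_mod_cast Nat.one_le_pow _ _ hb.pos
  · intro A hA η hη
    obtain ⟨c, hc, h⟩ := PolyLattice.exists_constc_le hα0 hγ0 hA hη
    refine ⟨c, hc, fun b hb s hs => ⟨(h b hb.two_le s hs).trans ?_, ?_⟩⟩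
    · have hb2 : (2 : ℝ) ≤ b := by exact_mod_cast hb.two_le
      -- The factor (b-1)^(2α) ≥ 1 is pure slack; the bound on B uses the sharper estimate without
      -- it.
      refine mul_le_mul_of_nonneg_right ?_ (by positivity)
      exact le_mul_of_one_le_right hc.le (Real.one_le_rpow (by linarith) (by linarith))
    · intro m hm p hp hpm q hq
      refine (PolyLattice.critB_le_constc hb hα0 hγ0 (by linarith : 0 < 2 * α) le_rfl
        hm hp hpm hq).trans (ENNReal.ofReal_le_ofReal ?_)
      have hN : (0 : ℝ) ≤ (b : ℝ) ^ m - 1 := by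
        rw [sub_nonneg]
        exact_mod_cast Nat.one_le_pow _ _ hb.pos
      rw [show -(2 * α + 1) + 2 * α = -1 by ring, Real.rpow_neg_one]
      exact mul_le_mul_of_nonneg_right (h b hb.two_le s hs) (inv_nonneg.2 hN)
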